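/- **Definitions.** Let $n\ge 1$ and $[n]=\{1,\dots,n\}$. A *multi-pointed partition* of $[n]$ is a partition of $[n]$ together with the choice of a non-empty subset of each block, called the pointed subset of the block; its elements are said to be pointed. The multi-pointed partitions of $[n]$ form a finite poset $\mathrm{M}\Pi^A_n$ whose order is generated by the following relations: $\pi\le\nu$ whenever $\nu$ is obtained from $\pi$ by gathering two blocks into one, the pointed subset of the new block being the pointed subset of the first block, that of the second block, or the union of both (the other blocks and their pointed subsets being unchanged). Its least element $\hat 0$ is the partition into singletons. For $1\le i\le n$, let $\mathrm{M}\Pi^A_{n,i}$ be the subposet of all multi-pointed partitions of $[n]$ in which the elements of $[i]$ are pointed, and let $\mathrm{M}\Pi^{A'}_{n,i}$ be the interval of $\mathrm{M}\Pi^A_n$ between $\hat 0$ and a multi-pointed partition with a single block and exactly $i$ pointed elements (up to isomorphism it does not depend on the choice of these elements). Put $\mathrm{M}\Pi^{A'}_{n,0}=\mathrm{M}\Pi^A_n$. The characteristic polynomial of a finite ranked poset $P$ with least element $\hat 0$, rank function $\operatorname{rk}$ and Möbius function $\mu$ is $\chi_P(x)=\sum_{a\in P}\mu(\hat 0,a)\,x^{N-\operatorname{rk}(a)}$,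 where $N$ is the rank of the maximal elements. For an integer $m\ge 0$, put $\langle m\rangle=\prod_{j=1}^m(x-j)$. **Theorem.** Let $n\ge 1$. For $1\le i\le n$, the characteristic polynomial of $\mathrm{M}\Pi^A_{n,i}$ is $$\mathrm{M}\chi^A_{n,i}(x)=\frac{x-2i}{x-i}\,\frac{\langle i\rangle\langle 2n-1\rangle}{\langle n+i\rangle},$$ and its constant term is $(-1)^{n-1}\,2\,\dfrac{i!\,(2n-1)!}{(n+i)!}$. For $0\le i\le n$, the characteristic polynomial of $\mathrm{M}\Pi^{A'}_{n,i}$ is $$\mathrm{M}\chi^{A'}_{n,i}(x)=\frac{\langle i\rangle\langle 2n-i-1\rangle}{\langle n\rangle},$$ and its constant term is $(-1)^{n-1}\,\dfrac{i!\,(2n-i-1)!}{n!}$. In particular, the characteristic polynomial of $\mathrm{M}\Pi^A_n$ is $\dfrac{\langle 2n-1\rangle}{\langle n\rangle}=\prod_{k=n+1}^{2n-1}(x-k)$. -/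

import Mathlib

open Finset Polynomial

/-- The characteristic polynomial `∑ a, μ(⊥, a) X ^ (n - rk a)` of a finite poset with a least
element, where `rk a` is the length of the longest chain from the least element to `a` (for a
ranked poset: the common length of all maximal chains from the least element to `a`) and `n` is
the largest rank, that is, the rank of the maximal elements. -/
noncomputable def posetCharPoly (P : Type*) [PartialOrder P] [OrderBot P] [Fintype P] : ℤ[X] :=
  letI : DecidableEq P := Classical.decEq P
  letI : DecidableLE P := Classical.decRel _
  letI : DecidableLT P := Classical.decRel _
  letI : LocallyFiniteOrder P := Fintype.toLocallyFiniteOrder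
  ∑ a : P, C (IncidenceAlgebra.mu ℤ (⊥ : P) a) *
    X ^ ((univ.sup fun b : P => (Order.height b).toNat) - (Order.height a).toNat)

/-- A multi-pointed partition of the finite set `s`: a partition of `s` together with a non-empty
subset of each block. It is recorded through the set of all pointed elements; the pointed subset of
a block `B` is `B ∩ pointed`. -/
@[ext]
structure MultiPointedPartition {α : Type*} [DecidableEq α] (s : Finset α) where
  /-- The underlying partition. -/
  partition : Finpartition s
  /-- The set of all pointed elements. -/
  pointed : Finset α
  pointed_subset : pointed ⊆ s
  nonempty_inter : ∀ B ∈ partition.parts, (B ∩ pointed).Nonempty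

namespace MultiPointedPartition

variable {α : Type*} [DecidableEq α] {s : Finset α}

/-- `π ≤ ν` if the partition of `π` refines that of `ν` and, in each block of `ν`, the pointed subset
is the union of the pointed subsets of some of the blocks of `π`: all pointed elements of `ν` are
pointed in `π`, and each block of `π` keeps either all or none of its pointed elements.
The theorem `le_iff_reflTransGen_merge` below shows that this is the order generated by gathering
two blocks into one, whose pointed subset is that of the first, that of the second, or their union. -/
instance : LE (MultiPointedPartition s) where
  le π ν := π.partition ≤ ν.partition ∧ ν.pointed ⊆ π.pointed ∧
    ∀ B ∈ π.partition.parts, B ∩ π.pointed ⊆ ν.pointed ∨ Disjoint B ν.pointed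

theorem le_def {π ν : MultiPointedPartition s} :
    π ≤ ν ↔ π.partition ≤ ν.partition ∧ ν.pointed ⊆ π.pointed ∧
      ∀ B ∈ π.partition.parts, B ∩ π.pointed ⊆ ν.pointed ∨ Disjoint B ν.pointed := Iff.rfl

instance : PartialOrder (MultiPointedPartition s) where
  le_refl π := ⟨le_rfl, Subset.rfl, fun _ _ => Or.inl inter_subset_right⟩
  le_trans π ν ρ h₁ h₂ := by
    refine ⟨h₁.1.trans h₂.1, h₂.2.1.trans h₁.2.1, fun B hB => ?_⟩
    obtain ⟨D, hD, hBD⟩ := h₁.1 hB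
    have hBD' : B ⊆ D := hBD
    rcases h₁.2.2 B hB with h | h
    · rcases h₂.2.2 D hD with h' | h'
      · exact Or.inl fun x hx => h' (mem_inter.2 ⟨hBD' (mem_inter.1 hx).1, h hx⟩)
      · exact Or.inr (h'.mono_left hBD)
    · exact Or.inr (h.mono_right h₂.2.1)
  le_antisymm π ν h₁ h₂ :=
    MultiPointedPartition.ext (h₁.1.antisymm h₂.1) (h₂.2.1.antisymm h₁.2.1)

/-- The least element: all blocks are singletons, and all elements are pointed. -/
instance : OrderBot (MultiPointedPartition s) where
  bot := ⟨⊥, s, Subset.rfl, fun B hB => by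
    rw [inter_eq_left.2 (Finpartition.subset _ hB)]
    exact Finpartition.nonempty_of_mem_parts _ hB⟩
  bot_le π := by
    refine ⟨bot_le, π.pointed_subset, fun B hB => ?_⟩
    obtain ⟨a, -, rfl⟩ := Finpartition.mem_bot_iff.1 hB
    by_cases ha : a ∈ π.pointed
    · exact Or.inl (inter_subset_left.trans (singleton_subset_iff.2 ha))
    · exact Or.inr (disjoint_singleton_left.2 ha)

noncomputable instance : Fintype (MultiPointedPartition s) :=
  Fintype.ofInjective
    (fun π => (π.partition, (⟨π.pointed, mem_powerset.2 π.pointed_subset⟩ : s.powerset)))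
    fun π ν h => by
      simp only [Prod.mk.injEq, Subtype.mk.injEq] at h
      exact MultiPointedPartition.ext h.1 h.2

/-- `ν` is obtained from `π` by gathering two blocks `B` and `D`, the pointed subset of `B ∪ D` being
the pointed subset of `B`, that of `D`, or their union. -/
def Merge (π ν : MultiPointedPartition s) : Prop :=
  ∃ B ∈ π.partition.parts, ∃ D ∈ π.partition.parts, B ≠ D ∧
    ν.partition.parts = insert (B ∪ D) ((π.partition.parts.erase B).erase D) ∧
    ν.pointed \ (B ∪ D) = π.pointed \ (B ∪ D) ∧
    (ν.pointed ∩ (B ∪ D) = B ∩ π.pointed ∨ ν.pointed ∩ (B ∪ D) = D ∩ π.pointed ∨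
      ν.pointed ∩ (B ∪ D) = (B ∪ D) ∩ π.pointed)

theorem Merge.le {π ν : MultiPointedPartition s} (h : Merge π ν) : π ≤ ν := by
  obtain ⟨B, hB, D, hD, hBD, hparts, hout, hin⟩ := h
  have key : ∀ x, x ∈ ν.pointed → x ∈ π.pointed := by
    intro x hx
    have h1 := Finset.ext_iff.1 hout x
    rcases hin with h | h | h <;> have h2 := Finset.ext_iff.1 h x <;> grind
  have dis : ∀ E ∈ π.partition.parts, ∀ F ∈ π.partition.parts, ∀ x, x ∈ E → x ∈ F → E = F :=
    fun E hE F hF x h1 h2 => Finpartition.eq_of_mem_parts _ hE hF h1 h2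
  refine ⟨fun E hE => ?_, key, fun E hE => ?_⟩
  · rw [hparts]
    by_cases h1 : E = B
    · exact ⟨B ∪ D, mem_insert_self _ _, h1 ▸ subset_union_left⟩
    by_cases h2 : E = D
    · exact ⟨B ∪ D, mem_insert_self _ _, h2 ▸ subset_union_right⟩
    exact ⟨E, by simp [h1, h2, hE], le_rfl⟩
  · rw [Finset.disjoint_left]
    by_cases h1 : E = B
    · subst h1
      rcases hin with h | h | h
      · left; intro x hx; have := Finset.ext_iff.1 h x; grind
      · right; intro x hx; have := Finset.ext_iff.1 h x; have := dis E hE D hD x hx; grind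
      · left; intro x hx; have := Finset.ext_iff.1 h x; grind
    by_cases h2 : E = D
    · subst h2
      rcases hin with h | h | h
      · right; intro x hx; have := Finset.ext_iff.1 h x; have := dis E hE B hB x hx; grind
      · left; intro x hx; have := Finset.ext_iff.1 h x; grind
      · left; intro x hx; have := Finset.ext_iff.1 h x; grind
    · left
      intro x hx
      have h3 := dis E hE B hB x
      have h4 := dis E hE D hD x
      have h5 := Finset.ext_iff.1 hout x
      grind

theorem exists_merge_of_lt {π ν : MultiPointedPartition s} (h : π ≤ ν) (hne : π ≠ ν) :
    ∃ ρ, Merge π ρ ∧ ρ ≤ ν ∧ #ρ.partition.parts < #π.partition.parts := by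
  have dis : ∀ E ∈ π.partition.parts, ∀ F ∈ π.partition.parts, ∀ x, x ∈ E → x ∈ F → E = F :=
    fun E hE F hF x h1 h2 => Finpartition.eq_of_mem_parts _ hE hF h1 h2
  have disν : ∀ E ∈ ν.partition.parts, ∀ F ∈ ν.partition.parts, ∀ x, x ∈ E → x ∈ F → E = F :=
    fun E hE F hF x h1 h2 => Finpartition.eq_of_mem_parts _ hE hF h1 h2
  have hnle : ¬ ν.partition ≤ π.partition := by
    intro hle
    have hp := h.1.antisymm hle
    refine hne (MultiPointedPartition.ext hp (Subset.antisymm (fun x hx => ?_) h.2.1))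
    obtain ⟨B, hB, hxB⟩ := π.partition.exists_mem (π.pointed_subset hx)
    rcases h.2.2 B hB with h' | h'
    · exact h' (mem_inter.2 ⟨hxB, hx⟩)
    · exact absurd (ν.nonempty_inter B (hp ▸ hB)) (by
        rw [disjoint_iff_inter_eq_empty.1 h']; exact not_nonempty_empty)
  obtain ⟨E, hE, hEn⟩ : ∃ E ∈ ν.partition.parts, ∀ B ∈ π.partition.parts, ¬ E ⊆ B := by
    by_contra! hcon
    exact hnle fun E hE => hcon E hE
  obtain ⟨a, ha⟩ := ν.nonempty_inter E hE
  rw [mem_inter] at ha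
  have sub : ∀ B ∈ π.partition.parts, ∀ x ∈ B, x ∈ E → B ⊆ E := by
    intro B hB x hx hxE
    obtain ⟨F, hF, hBF⟩ := h.1 hB
    rw [disν E hE F hF x hxE (hBF hx)]
    exact hBF
  obtain ⟨B, hB, haB⟩ := π.partition.exists_mem (ν.pointed_subset ha.2)
  obtain ⟨b, hbE, hbB⟩ := not_subset.1 (hEn B hB)
  obtain ⟨D, hD, hbD⟩ := π.partition.exists_mem (ν.partition.subset hE hbE)
  have hBE := sub B hB a haB ha.1
  have hDE := sub D hD b hbD hbE
  have hBD : B ≠ D := fun h => hbB (h ▸ hbD)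
  have hBν : B ∩ π.pointed ⊆ ν.pointed := (h.2.2 B hB).resolve_right fun h' =>
    Finset.disjoint_left.1 h' haB ha.2
  have hBDd : ∀ x ∈ B, x ∉ D := fun x h1 h2 => hBD (dis B hB D hD x h1 h2)
  let parts' := insert (B ∪ D) ((π.partition.parts.erase B).erase D)
  have hsub : ∀ p ∈ parts', p ⊆ s := by
    intro p hp
    rcases mem_insert.1 hp with rfl | hp
    · exact union_subset (π.partition.subset hB) (π.partition.subset hD)
    · exact π.partition.subset (mem_of_mem_erase (mem_of_mem_erase hp))
  have huniq : ∀ x ∈ s, ∃! t ∈ parts', x ∈ t := by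
    intro x hx
    obtain ⟨F, hF, hxF⟩ := π.partition.exists_mem hx
    by_cases hxBD : x ∈ B ∪ D
    · refine ⟨B ∪ D, ⟨mem_insert_self _ _, hxBD⟩, ?_⟩
      rintro t ⟨ht, hxt⟩
      rcases mem_insert.1 ht with rfl | ht
      · rfl
      · have h1 := dis t (by grind) B hB x hxt
        have h2 := dis t (by grind) D hD x hxt
        grind
    · refine ⟨F, ⟨by grind, hxF⟩, ?_⟩
      rintro t ⟨ht, hxt⟩
      rcases mem_insert.1 ht with rfl | ht
      · exact absurd hxt hxBD
      · exact dis t (by grind) F hF x hxt hxF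
  have hemp : ∅ ∉ parts' := by
    intro hp
    rcases mem_insert.1 hp with hp | hp
    · have : a ∈ (∅ : Finset α) := hp ▸ mem_union_left D haB
      simp at this
    · exact π.partition.empty_notMem_parts (mem_of_mem_erase (mem_of_mem_erase hp))
  let ρ : MultiPointedPartition s :=
    { partition := Finpartition.ofExistsUnique parts' hsub huniq hemp
      pointed := π.pointed \ (D \ ν.pointed)
      pointed_subset := sdiff_subset.trans π.pointed_subset
      nonempty_inter := by
        intro F hF
        rcases mem_insert.1 (show F ∈ parts' from hF) with rfl | hF
        · have := h.2.1 ha.2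
          exact ⟨a, by grind⟩
        · have hF' : F ∈ π.partition.parts := mem_of_mem_erase (mem_of_mem_erase hF)
          obtain ⟨x, hx⟩ := π.nonempty_inter F hF'
          have := dis F hF' D hD x
          exact ⟨x, by grind⟩ }
  have hρ : ρ.partition.parts = parts' := rfl
  have hρp : ρ.pointed = π.pointed \ (D \ ν.pointed) := rfl
  refine ⟨ρ, ⟨B, hB, D, hD, hBD, hρ, ?_, ?_⟩, ⟨fun F hF => ?_, ?_, fun F hF => ?_⟩, ?_⟩
  · rw [hρp]; ext x; grind
  · rw [hρp]
    rcases h.2.2 D hD with h' | h'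
    · right; right
      ext x
      have h1 := @h' x
      simp only [mem_inter, mem_sdiff, mem_union] at h1 ⊢
      tauto
    · left
      ext x
      have h1 : x ∈ D → x ∉ ν.pointed := fun hx => Finset.disjoint_left.1 h' hx
      have h2 := @hBν x
      have h3 := hBDd x
      simp only [mem_inter, mem_sdiff, mem_union] at h2 ⊢
      tauto
  · rcases mem_insert.1 (show F ∈ parts' from hF) with rfl | hF
    · exact ⟨E, hE, union_subset hBE hDE⟩
    · exact h.1 (mem_of_mem_erase (mem_of_mem_erase hF))
  · intro x hx
    have := h.2.1 hx
    rw [hρp]; grind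
  · rw [hρp]
    rcases mem_insert.1 (show F ∈ parts' from hF) with rfl | hF
    · left
      intro x hx
      have h2 := @hBν x
      simp only [mem_inter, mem_sdiff, mem_union] at h2 hx
      tauto
    · rcases h.2.2 F (mem_of_mem_erase (mem_of_mem_erase hF)) with h' | h'
      · left
        intro x hx
        have h2 := @h' x
        simp only [mem_inter, mem_sdiff] at h2 hx
        tauto
      · exact Or.inr h'
  · have h1 : #parts' ≤ #((π.partition.parts.erase B).erase D) + 1 := card_insert_le _ _
    have h2 : D ∈ π.partition.parts.erase B := mem_erase.2 ⟨hBD.symm, hD⟩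
    have h3 := card_erase_of_mem h2
    have h4 := card_erase_of_mem hB
    have h5 : 0 < #(π.partition.parts.erase B) := card_pos.2 ⟨D, h2⟩
    rw [hρ]
    lia

/-- The order is the reflexive-transitive closure of gathering two blocks. -/
theorem le_iff_reflTransGen_merge {π ν : MultiPointedPartition s} :
    π ≤ ν ↔ Relation.ReflTransGen Merge π ν := by
  constructor
  · intro h
    induction hk : #π.partition.parts using Nat.strong_induction_on generalizing π with
    | _ k ih =>
      by_cases hne : π = ν
      · exact hne ▸ Relation.ReflTransGen.refl
      · obtain ⟨ρ, h1, h2, h3⟩ := exists_merge_of_lt h hne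
        exact Relation.ReflTransGen.head h1 (ih _ (hk ▸ h3) h2 rfl)
  · intro h
    induction h with
    | refl => exact le_rfl
    | tail _ h ih => exact ih.trans h.le

/-- The multi-pointed partition with the single block `s`, in which the elements of `p` are
pointed. -/
def oneBlock (p : Finset α) (hp : p.Nonempty) (hps : p ⊆ s) : MultiPointedPartition s where
  partition := Finpartition.indiscrete (hp.mono hps).ne_empty
  pointed := p
  pointed_subset := hps
  nonempty_inter B hB := by
    rw [Finpartition.indiscrete_parts, mem_singleton] at hB
    rw [hB, inter_eq_right.2 hps]
    exact hp

/-- The interval between the least element and the one-block multi-pointed partition whose pointed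
subset is `p`. -/
abbrev MaximalInterval (p : Finset α) (hp : p.Nonempty) (hps : p ⊆ s) : Type _ :=
  Set.Iic (oneBlock p hp hps)

noncomputable instance (p : Finset α) (hp : p.Nonempty) (hps : p ⊆ s) :
    Fintype (MaximalInterval p hp hps) := Fintype.ofFinite _

/-- The multi-pointed partitions of `s` in which all elements of `t ⊆ s` are pointed. -/
def WithPointed (t : Finset α) (_hts : t ⊆ s) : Type _ :=
  {π : MultiPointedPartition s // t ⊆ π.pointed}

/-- The induced order. -/
instance (t : Finset α) (hts : t ⊆ s) : PartialOrder (WithPointed t hts) :=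
  inferInstanceAs (PartialOrder {π : MultiPointedPartition s // t ⊆ π.pointed})

instance (t : Finset α) (hts : t ⊆ s) : OrderBot (WithPointed t hts) where
  bot := ⟨⊥, hts⟩
  bot_le π := (bot_le : ⊥ ≤ π.1)

noncomputable instance (t : Finset α) (hts : t ⊆ s) : Fintype (WithPointed t hts) :=
  haveI : Finite (WithPointed t hts) :=
    inferInstanceAs (Finite {π : MultiPointedPartition s // t ⊆ π.pointed})
  Fintype.ofFinite _

end MultiPointedPartition

/-- `⟨m⟩ = ∏_{j = 1}^{m} (X - j)`. -/
noncomputable def angleBracket (m : ℕ) : ℤ[X] := ∏ j ∈ Icc 1 m, (X - C (j : ℤ))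

/-- The falling factorial `y (y - 1) ⋯ (y - j + 1)` of an integer. -/
def fallingFactorial (j : ℕ) (y : ℤ) : ℤ := ∏ l ∈ range j, (y - l)

/-- The number of ways to place `k` labelled disjoint dimers on a cycle of length `x`, as a polynomial
function of `x`. -/
def dimerCount (k : ℕ) (x : ℤ) : ℤ := if k = 0 then 1 else x * ∏ l ∈ Ico (k + 1) (2 * k), (x - l)

theorem fallingFactorial_zero (y : ℤ) : fallingFactorial 0 y = 1 := by simp [fallingFactorial]

theorem fallingFactorial_at_zero {j : ℕ} (hj : j ≠ 0) : fallingFactorial j 0 = 0 := by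
  rw [fallingFactorial, prod_eq_zero (mem_range.2 (Nat.pos_of_ne_zero hj))]
  simp

theorem fallingFactorial_add_one_sub (j : ℕ) (y : ℤ) :
    fallingFactorial j (y + 1) - fallingFactorial j y = j * fallingFactorial (j - 1) y := by
  cases j with
  | zero => simp [fallingFactorial]
  | succ j =>
    have h1 : fallingFactorial (j + 1) (y + 1) = (y + 1) * fallingFactorial j y := by
      simp only [fallingFactorial]
      rw [prod_range_succ', mul_comm]
      push_cast
      congr 1
      · ring
      · exact prod_congr rfl fun l _ => by ring
    have h2 : fallingFactorial (j + 1) y = fallingFactorial j y * (y - j) := prod_range_succ _ _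
    rw [h1, h2, Nat.add_sub_cancel]
    push_cast
    ring

theorem dimerCount_zero (x : ℤ) : dimerCount 0 x = 1 := rfl

theorem dimerCount_at_zero {k : ℕ} (hk : k ≠ 0) : dimerCount k 0 = 0 := by
  simp [dimerCount, hk]

theorem dimerCount_add_one_sub (k : ℕ) (x : ℤ) :
    dimerCount k (x + 1) - dimerCount k x = k * dimerCount (k - 1) (x - 1) := by
  rcases k with _ | _ | k
  · simp [dimerCount]
  · simp [dimerCount]
  · have h1 : ∏ l ∈ Ico (k + 1 + 1 + 1) (2 * (k + 1 + 1)), (x + 1 - (l : ℤ)) =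
        (x - k - 2) * ∏ l ∈ Ico (k + 3) (2 * k + 3), (x - (l : ℤ)) := by
      rw [show 2 * (k + 1 + 1) = 2 * k + 3 + 1 by ring,
        ← prod_Ico_add' (fun l : ℕ => x + 1 - (l : ℤ)) (k + 2) (2 * k + 3) 1,
        prod_eq_prod_Ico_succ_bot (by lia)]
      congr 1
      · push_cast; ring
      · exact prod_congr rfl fun l _ => by push_cast; ring
    have h2 : ∏ l ∈ Ico (k + 1 + 1 + 1) (2 * (k + 1 + 1)), (x - (l : ℤ)) =
        (∏ l ∈ Ico (k + 3) (2 * k + 3), (x - (l : ℤ))) * (x - 2 * k - 3) := by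
      rw [show 2 * (k + 1 + 1) = 2 * k + 3 + 1 by ring, prod_Ico_succ_top (by lia)]
      push_cast
      congr 1
      ring
    have h3 : ∏ l ∈ Ico (k + 1 + 1) (2 * (k + 1)), (x - 1 - (l : ℤ)) =
        ∏ l ∈ Ico (k + 3) (2 * k + 3), (x - (l : ℤ)) := by
      rw [← prod_Ico_add' (fun l : ℕ => x - (l : ℤ)) (k + 2) (2 * k + 2) 1]
      exact prod_congr (by congr 1) fun l _ => by push_cast; ring
    simp only [dimerCount, Nat.add_sub_cancel, Nat.add_eq_zero_iff, one_ne_zero, and_false, if_false]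
    rw [h1, h2, h3]
    push_cast
    ring

/-- Two functions on the integers with the same differences and the same value at `0` agree. -/
theorem eq_of_add_one_sub_eq {f g : ℤ → ℤ} (h0 : f 0 = g 0)
    (h : ∀ x, f (x + 1) - f x = g (x + 1) - g x) (x : ℤ) : f x = g x := by
  induction x using Int.induction_on with
  | zero => exact h0
  | succ n ih => have := h n; lia
  | pred n ih => have := h (-n - 1); rw [sub_add_cancel] at this; lia

namespace Finpartition

variable {α : Type*} [DecidableEq α] {s : Finset α}

theorem parts_avoid_of_mem (τ : Finpartition s) {C : Finset α} (hC : C ∈ τ.parts) :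
    (τ.avoid C).parts = τ.parts.erase C := by
  have key : ∀ D ∈ τ.parts, D ≠ C → D \ C = D := fun D hD hne =>
    sdiff_eq_self_of_disjoint (τ.disjoint hD hC hne)
  ext D
  rw [mem_avoid, mem_erase]
  constructor
  · rintro ⟨E, hE, hEC, rfl⟩
    have hne : E ≠ C := fun h => hEC h.le
    rw [key E hE hne]
    exact ⟨hne, hE⟩
  · rintro ⟨hne, hD⟩
    refine ⟨D, hD, fun hle => ?_, key D hD hne⟩
    obtain ⟨x, hx⟩ := τ.nonempty_of_mem_parts hD
    exact hne (τ.eq_of_mem_parts hD hC hx (hle hx))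

/-- Summing over the partitions of `s` with a distinguished block `C` amounts to summing over the
non-empty subsets `C` of `s` and the partitions of `s \ C`. -/
theorem sum_sum_parts {M : Type*} [AddCommMonoid M] (H : Finset (Finset α) → Finset α → M) :
    ∑ τ : Finpartition s, ∑ C ∈ τ.parts, H (τ.parts.erase C) C =
      ∑ C ∈ s.powerset.erase ∅, ∑ τ : Finpartition (s \ C), H τ.parts C := by
  rw [sum_sigma', sum_sigma']
  have hext : ∀ x ∈ (s.powerset.erase ∅).sigma
      fun C => (univ : Finset (Finpartition (s \ C))), x.1 ≠ ⊥ ∧ Disjoint (s \ x.1) x.1 ∧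
        s \ x.1 ⊔ x.1 = s ∧ x.1 ∉ x.2.parts := by
    intro x hx
    obtain ⟨h1, h2⟩ := mem_erase.1 (mem_sigma.1 hx).1
    refine ⟨h1, sdiff_disjoint, sdiff_union_of_subset (mem_powerset.1 h2), fun h => h1 ?_⟩
    have := x.2.subset h
    rw [← disjoint_self_iff_empty]
    exact sdiff_disjoint.mono_left this
  refine sum_bij' (fun x _ => ⟨x.2, x.1.avoid x.2⟩)
    (fun x hx => ⟨x.2.extend (hext x hx).1 (hext x hx).2.1 (hext x hx).2.2.1, x.1⟩) ?_ ?_ ?_ ?_ ?_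
  · intro x hx
    have hx := (mem_sigma.1 hx).2
    simp only [mem_sigma, mem_univ, and_true, mem_erase, mem_powerset]
    exact ⟨x.1.ne_empty hx, x.1.subset hx⟩
  · intro x hx
    simp only [mem_sigma, mem_univ, true_and]
    exact mem_insert_self _ _
  · intro x hx
    have hx := (mem_sigma.1 hx).2
    refine Sigma.ext (Finpartition.ext ?_) HEq.rfl
    change insert x.2 (x.1.avoid x.2).parts = _
    rw [parts_avoid_of_mem _ hx, insert_erase hx]
  · intro x hx
    refine Sigma.ext rfl (heq_of_eq (Finpartition.ext ?_))
    dsimp only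
    rw [parts_avoid_of_mem _ (mem_insert_self _ _)]
    exact erase_insert (hext x hx).2.2.2
  · intro x hx
    have hx := (mem_sigma.1 hx).2
    dsimp only
    rw [parts_avoid_of_mem _ hx]

theorem sum_dimerCount_mul_prod (s : Finset α) (x : ℤ) :
    ∑ τ : Finpartition s, dimerCount #τ.parts x * ∏ C ∈ τ.parts, ((2 : ℤ) ^ #C - 1) = x ^ #s := by
  induction hn : #s using Nat.strong_induction_on generalizing s x with
  | _ n ih =>
  subst hn
  rcases s.eq_empty_or_nonempty with rfl | hs
  · rw [Fintype.sum_eq_single (⊥ : Finpartition (∅ : Finset α))]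
    · simp [dimerCount_zero]
    · intro τ hτ
      exact absurd (Subsingleton.elim (α := Finpartition (⊥ : Finset α)) τ ⊥) hτ
  revert x
  refine eq_of_add_one_sub_eq ?_ fun x => ?_
  · rw [zero_pow (card_ne_zero.2 hs)]
    refine sum_eq_zero fun τ _ => ?_
    rw [dimerCount_at_zero (card_ne_zero.2 (τ.parts_nonempty hs.ne_empty)), zero_mul]
  · have h1 : ∀ τ : Finpartition s,
        dimerCount #τ.parts (x + 1) * ∏ C ∈ τ.parts, ((2 : ℤ) ^ #C - 1) -
          dimerCount #τ.parts x * ∏ C ∈ τ.parts, ((2 : ℤ) ^ #C - 1) =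
        ∑ C ∈ τ.parts, ((2 : ℤ) ^ #C - 1) * (dimerCount #(τ.parts.erase C) (x - 1) *
          ∏ D ∈ τ.parts.erase C, ((2 : ℤ) ^ #D - 1)) := by
      intro τ
      rw [← sub_mul, dimerCount_add_one_sub, mul_assoc, ← nsmul_eq_mul, ← sum_const]
      refine sum_congr rfl fun C hC => ?_
      rw [card_erase_of_mem hC, ← mul_prod_erase _ _ hC]
      ring
    rw [← sum_sub_distrib, sum_congr rfl fun τ _ => h1 τ,
      sum_sum_parts fun P C => ((2 : ℤ) ^ #C - 1) * (dimerCount #P (x - 1) *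
          ∏ D ∈ P, ((2 : ℤ) ^ #D - 1))]
    have h2 : ∀ C ∈ s.powerset.erase ∅, ∑ τ : Finpartition (s \ C), ((2 : ℤ) ^ #C - 1) *
        (dimerCount #τ.parts (x - 1) * ∏ D ∈ τ.parts, ((2 : ℤ) ^ #D - 1)) =
        2 ^ #C * (x - 1) ^ (#s - #C) - 1 ^ #C * (x - 1) ^ (#s - #C) := by
      intro C hC
      obtain ⟨h1, h2⟩ := mem_erase.1 hC
      rw [mem_powerset] at h2
      have h3 : 0 < #C := card_pos.2 (nonempty_iff_ne_empty.2 h1)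
      have h4 := card_le_card h2
      rw [← mul_sum, ih #(s \ C) (by rw [card_sdiff_of_subset h2]; lia) _ _ rfl,
        card_sdiff_of_subset h2]
      ring
    rw [sum_congr rfl h2, sum_erase _ (by simp), sum_sub_distrib, sum_pow_mul_eq_add_pow,
      sum_pow_mul_eq_add_pow]
    ring

end Finpartition

namespace Finpartition

variable {α : Type*} [DecidableEq α] {s : Finset α}

/-- The number of admissible pointed subsets of a block `C` when those of the blocks that meet `t`
have to contain `C ∩ t`, with `c` choices for each of the other elements. -/
def pointingWeight (c : ℤ) (t C : Finset α) : ℤ :=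
  if Disjoint C t then 2 ^ #C - 1 else c ^ #(C \ t)

/-- The value attached to a set of blocks of which `j` meet `t` and `k` do not. -/
def blockValue (c : ℤ) (t : Finset α) (y x : ℤ) (P : Finset (Finset α)) : ℤ :=
  fallingFactorial #(P.filter fun C => ¬ Disjoint C t) y *
    dimerCount #(P.filter fun C => Disjoint C t) (x - c * #(P.filter fun C => ¬ Disjoint C t))

theorem blockValue_erase (c : ℤ) {t : Finset α} (y x : ℤ) {P : Finset (Finset α)} {C : Finset α}
    (hC : C ∈ P) (hCt : ¬ Disjoint C t) :
    blockValue c t y (x - c) (P.erase C) =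
      fallingFactorial (#(P.filter fun C => ¬ Disjoint C t) - 1) y *
        dimerCount #(P.filter fun C => Disjoint C t)
          (x - c * #(P.filter fun C => ¬ Disjoint C t)) := by
  have hmem : C ∈ P.filter fun C => ¬ Disjoint C t := mem_filter.2 ⟨hC, hCt⟩
  have h1 : (P.erase C).filter (fun C => Disjoint C t) = P.filter fun C => Disjoint C t := by
    rw [filter_erase, erase_eq_of_notMem]
    simp [hCt]
  rw [blockValue, h1, filter_erase, card_erase_of_mem hmem]
  congr 2
  rw [Nat.cast_sub (card_pos.2 ⟨C, hmem⟩)]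
  push_cast
  ring

theorem prod_ite_mem_eq_pow (C t : Finset α) (a b : ℤ) :
    ∏ i ∈ C, (if i ∈ t then a else b) = a ^ #(C ∩ t) * b ^ #(C \ t) := by
  rw [prod_ite, prod_const, prod_const, filter_mem_eq_inter, filter_notMem_eq_sdiff]

theorem sum_blockValue_mul_prod (c : ℤ) (s t : Finset α) (y x : ℤ) :
    ∑ τ : Finpartition s, blockValue c t y x τ.parts * ∏ C ∈ τ.parts, pointingWeight c t C =
      y ^ #(s ∩ t) * x ^ #(s \ t) := by
  induction hn : #s using Nat.strong_induction_on generalizing s x y with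
  | _ n ih =>
  subst hn
  by_cases hst : Disjoint s t
  · rw [disjoint_iff_inter_eq_empty.1 hst, sdiff_eq_self_of_disjoint hst, card_empty, pow_zero,
      one_mul, ← sum_dimerCount_mul_prod]
    refine sum_congr rfl fun τ _ => ?_
    have hτ : ∀ C ∈ τ.parts, Disjoint C t := fun C hC => hst.mono_left (τ.subset hC)
    congr 1
    · rw [blockValue, filter_true_of_mem hτ, filter_false_of_mem fun C hC h => h (hτ C hC)]
      simp [fallingFactorial_zero]
    · exact prod_congr rfl fun C hC => if_pos (hτ C hC)
  revert y
  refine eq_of_add_one_sub_eq ?_ fun y => ?_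
  · obtain ⟨a, has, hat⟩ := not_disjoint_iff.1 hst
    rw [zero_pow (card_ne_zero.2 ⟨a, mem_inter.2 ⟨has, hat⟩⟩), zero_mul]
    refine sum_eq_zero fun τ _ => ?_
    obtain ⟨C, hC, haC⟩ := τ.exists_mem has
    rw [blockValue, fallingFactorial_at_zero, zero_mul, zero_mul]
    exact card_ne_zero.2 ⟨C, mem_filter.2 ⟨hC, not_disjoint_iff.2 ⟨a, haC, hat⟩⟩⟩
  · have h1 : ∀ τ : Finpartition s,
        blockValue c t (y + 1) x τ.parts * ∏ C ∈ τ.parts, pointingWeight c t C -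
          blockValue c t y x τ.parts * ∏ C ∈ τ.parts, pointingWeight c t C =
        ∑ C ∈ τ.parts, if Disjoint C t then 0 else c ^ #(C \ t) *
          (blockValue c t y (x - c) (τ.parts.erase C) *
            ∏ D ∈ τ.parts.erase C, pointingWeight c t D) := by
      intro τ
      rw [← sub_mul, blockValue, blockValue, ← sub_mul, fallingFactorial_add_one_sub, mul_assoc,
        mul_assoc, ← nsmul_eq_mul, ← sum_const, sum_filter]
      refine sum_congr rfl fun C hC => ?_
      by_cases hCt : Disjoint C t
      · simp [hCt]
      · rw [if_pos hCt, if_neg hCt, blockValue_erase c y x hC hCt, ← mul_prod_erase _ _ hC,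
          pointingWeight, if_neg hCt]
        ring
    rw [← sum_sub_distrib, sum_congr rfl fun τ _ => h1 τ,
      sum_sum_parts fun P C => if Disjoint C t then 0 else c ^ #(C \ t) *
          (blockValue c t y (x - c) P * ∏ D ∈ P, pointingWeight c t D)]
    have h2 : ∀ C ∈ s.powerset.erase ∅, ∑ τ : Finpartition (s \ C),
        (if Disjoint C t then 0 else c ^ #(C \ t) *
          (blockValue c t y (x - c) τ.parts * ∏ D ∈ τ.parts, pointingWeight c t D)) =
        (∏ i ∈ C, if i ∈ t then 1 else c) * (∏ i ∈ s \ C, if i ∈ t then y else x - c) -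
        (∏ i ∈ C, if i ∈ t then 0 else c) * (∏ i ∈ s \ C, if i ∈ t then y else x - c) := by
      intro C hC
      obtain ⟨h1, h2⟩ := mem_erase.1 hC
      rw [mem_powerset] at h2
      have h3 : 0 < #C := card_pos.2 (nonempty_iff_ne_empty.2 h1)
      have h4 := card_le_card h2
      rw [prod_ite_mem_eq_pow C t 1, prod_ite_mem_eq_pow C t 0, prod_ite_mem_eq_pow (s \ C)]
      split_ifs with hCt
      · rw [disjoint_iff_inter_eq_empty.1 hCt]
        simp
      · rw [← mul_sum, ih #(s \ C) (by rw [card_sdiff_of_subset h2]; lia) _ _ _ rfl,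
          zero_pow (card_ne_zero.2 (nonempty_iff_ne_empty.2
            (mt disjoint_iff_inter_eq_empty.2 hCt)))]
        ring
    rw [sum_congr rfl h2, sum_erase _ (by simp), sum_sub_distrib, ← prod_add, ← prod_add]
    have h3 : ∀ u : ℤ, ∏ i ∈ s, ((if i ∈ t then u else c) + if i ∈ t then y else x - c) =
        (u + y) ^ #(s ∩ t) * x ^ #(s \ t) := by
      intro u
      rw [← prod_ite_mem_eq_pow]
      refine prod_congr rfl fun i _ => ?_
      split_ifs <;> ring
    rw [h3, h3]
    ring

/-- Choosing a subset of `s` amounts to choosing a subset of each block. -/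
theorem card_filter_forall_inter (τ : Finpartition s) (ok : Finset α → Finset α → Prop)
    [∀ C P, Decidable (ok C P)] :
    #{T ∈ s.powerset | ∀ C ∈ τ.parts, ok C (C ∩ T)} =
      ∏ C ∈ τ.parts, #{P ∈ C.powerset | ok C P} := by
  rw [← card_pi]
  have key : ∀ f : (∀ C ∈ τ.parts, Finset α), (∀ C hC, f C hC ⊆ C) → ∀ C hC,
      C ∩ (τ.parts.attach.biUnion fun D => f D.1 D.2) = f C hC := by
    intro f hf C hC
    ext x
    simp only [mem_inter, mem_biUnion, mem_attach, true_and, Subtype.exists]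
    constructor
    · rintro ⟨hx, D, hD, hxD⟩
      obtain rfl := τ.eq_of_mem_parts hC hD hx (hf D hD hxD)
      exact hxD
    · exact fun hx => ⟨hf C hC hx, C, hC, hx⟩
  refine card_bij' (fun T _ C _ => C ∩ T) (fun f _ => τ.parts.attach.biUnion fun D => f D.1 D.2)
    ?_ ?_ ?_ ?_
  · intro T hT
    rw [mem_filter] at hT
    exact mem_pi.2 fun C hC => mem_filter.2 ⟨mem_powerset.2 inter_subset_left, hT.2 C hC⟩
  · intro f hf
    have hf1 : ∀ C hC, f C hC ⊆ C := fun C hC =>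
      mem_powerset.1 (mem_filter.1 (mem_pi.1 hf C hC)).1
    refine mem_filter.2 ⟨mem_powerset.2 (biUnion_subset.2 fun D _ =>
      (hf1 D.1 D.2).trans (τ.subset D.2)), fun C hC => ?_⟩
    rw [key f hf1 C hC]
    exact (mem_filter.1 (mem_pi.1 hf C hC)).2
  · intro T hT
    have hT := mem_powerset.1 (mem_filter.1 hT).1
    ext x
    simp only [mem_biUnion, mem_attach, true_and, Subtype.exists, mem_inter]
    constructor
    · rintro ⟨_, _, _, h⟩
      exact h
    · intro hx
      obtain ⟨C, hC, hxC⟩ := τ.exists_mem (hT hx)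
      exact ⟨C, hC, hxC, hx⟩
  · intro f hf
    funext C hC
    exact key f (fun C hC => mem_powerset.1 (mem_filter.1 (mem_pi.1 hf C hC)).1) C hC

end Finpartition

namespace Finpartition

variable {α : Type*} [DecidableEq α] {s : Finset α}

/-- The partition of `s` whose blocks are the unions of the blocks of a partition of the set of blocks
of `ρ`. -/
def coarsen (ρ : Finpartition s) (τ : Finpartition ρ.parts) : Finpartition s :=
  ofExistsUnique (τ.parts.image fun C => C.biUnion id)
    (by
      intro p hp
      obtain ⟨C, hC, rfl⟩ := mem_image.1 hp
      exact biUnion_subset.2 fun A hA => ρ.subset (τ.subset hC hA))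
    (by
      intro x hx
      obtain ⟨A, hA, hxA⟩ := ρ.exists_mem hx
      obtain ⟨C, hC, hAC⟩ := τ.exists_mem hA
      refine ⟨C.biUnion id, ⟨mem_image_of_mem _ hC, mem_biUnion.2 ⟨A, hAC, hxA⟩⟩, ?_⟩
      rintro p ⟨hp, hxp⟩
      obtain ⟨D, hD, rfl⟩ := mem_image.1 hp
      obtain ⟨A', hA', hxA'⟩ := mem_biUnion.1 hxp
      obtain rfl := ρ.eq_of_mem_parts hA (τ.subset hD hA') hxA hxA'
      rw [τ.eq_of_mem_parts hC hD hAC hA'])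
    (by
      intro h
      obtain ⟨C, hC, hC0⟩ := mem_image.1 h
      obtain ⟨A, hA⟩ := τ.nonempty_of_mem_parts hC
      obtain ⟨x, hx⟩ := ρ.nonempty_of_mem_parts (τ.subset hC hA)
      have : x ∈ C.biUnion id := mem_biUnion.2 ⟨A, hA, hx⟩
      rw [hC0] at this
      exact notMem_empty x this)

theorem parts_coarsen (ρ : Finpartition s) (τ : Finpartition ρ.parts) :
    (ρ.coarsen τ).parts = τ.parts.image fun C => C.biUnion id := rfl

theorem le_coarsen (ρ : Finpartition s) (τ : Finpartition ρ.parts) : ρ ≤ ρ.coarsen τ := by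
  intro A hA
  obtain ⟨C, hC, hAC⟩ := τ.exists_mem hA
  exact ⟨_, mem_image_of_mem _ hC, subset_biUnion_of_mem id hAC⟩

/-- A partition of `s` that is coarser than `ρ`, seen as a partition of the set of blocks of `ρ`. -/
def quotient (ρ σ : Finpartition s) (h : ρ ≤ σ) : Finpartition ρ.parts :=
  ofExistsUnique (σ.parts.image fun B => ρ.parts.filter fun A => A ⊆ B)
    (by
      intro p hp
      obtain ⟨B, hB, rfl⟩ := mem_image.1 hp
      exact filter_subset _ _)
    (by
      intro A hA
      obtain ⟨B, hB, hAB⟩ := h hA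
      refine ⟨ρ.parts.filter fun A => A ⊆ B,
        ⟨mem_image_of_mem _ hB, mem_filter.2 ⟨hA, hAB⟩⟩, ?_⟩
      rintro p ⟨hp, hAp⟩
      obtain ⟨D, hD, rfl⟩ := mem_image.1 hp
      obtain ⟨x, hx⟩ := ρ.nonempty_of_mem_parts hA
      rw [σ.eq_of_mem_parts hB hD (hAB hx) ((mem_filter.1 hAp).2 hx)])
    (by
      intro hp
      obtain ⟨B, hB, hB0⟩ := mem_image.1 hp
      obtain ⟨A, hA, hAB⟩ := exists_le_of_le h hB
      exact filter_eq_empty_iff.1 hB0 hA hAB)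

theorem parts_quotient (ρ σ : Finpartition s) (h : ρ ≤ σ) :
    (ρ.quotient σ h).parts = σ.parts.image fun B => ρ.parts.filter fun A => A ⊆ B := rfl

theorem filter_subset_biUnion (ρ : Finpartition s) {C : Finset (Finset α)} (hC : C ⊆ ρ.parts) :
    (ρ.parts.filter fun A => A ⊆ C.biUnion id) = C := by
  ext A
  rw [mem_filter]
  constructor
  · rintro ⟨hA, hAC⟩
    obtain ⟨x, hx⟩ := ρ.nonempty_of_mem_parts hA
    obtain ⟨A', hA', hxA'⟩ := mem_biUnion.1 (hAC hx)
    rwa [ρ.eq_of_mem_parts hA (hC hA') hx hxA']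
  · exact fun hA => ⟨hC hA, subset_biUnion_of_mem id hA⟩

theorem biUnion_filter_subset {ρ σ : Finpartition s} (h : ρ ≤ σ) {B : Finset α}
    (hB : B ∈ σ.parts) : (ρ.parts.filter fun A => A ⊆ B).biUnion id = B := by
  ext x
  simp only [mem_biUnion, mem_filter, id]
  constructor
  · rintro ⟨A, ⟨_, hAB⟩, hx⟩
    exact hAB hx
  · intro hx
    obtain ⟨A, hA, hxA⟩ := ρ.exists_mem (σ.subset hB hx)
    obtain ⟨D, hD, hAD⟩ := h hA
    obtain rfl := σ.eq_of_mem_parts hB hD hx (hAD hxA)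
    exact ⟨A, ⟨hA, hAD⟩, hxA⟩

theorem quotient_coarsen (ρ : Finpartition s) (τ : Finpartition ρ.parts) :
    ρ.quotient (ρ.coarsen τ) (ρ.le_coarsen τ) = τ := by
  refine Finpartition.ext ?_
  rw [parts_quotient, parts_coarsen, image_image]
  refine (image_congr fun C hC => ?_).trans image_id
  exact ρ.filter_subset_biUnion (τ.subset hC)

theorem coarsen_quotient (ρ σ : Finpartition s) (h : ρ ≤ σ) :
    ρ.coarsen (ρ.quotient σ h) = σ := by
  refine Finpartition.ext ?_
  rw [parts_coarsen, parts_quotient, image_image]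
  refine (image_congr fun B hB => ?_).trans image_id
  exact biUnion_filter_subset h hB

theorem injOn_biUnion (ρ : Finpartition s) :
    Set.InjOn (fun C : Finset (Finset α) => C.biUnion id) {C | C ⊆ ρ.parts} := by
  intro C hC D hD h
  rw [← ρ.filter_subset_biUnion hC, ← ρ.filter_subset_biUnion hD]
  dsimp only at h
  rw [h]

/-- The blocks of a partition that meet `t`. -/
def meeting (ρ : Finpartition s) (t : Finset α) : Finset (Finset α) :=
  ρ.parts.filter fun A => ¬ Disjoint A t

theorem mem_meeting {ρ : Finpartition s} {t A : Finset α} :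
    A ∈ ρ.meeting t ↔ A ∈ ρ.parts ∧ ∃ x ∈ A, x ∈ t := by
  rw [meeting, mem_filter, not_disjoint_iff]

theorem disjoint_biUnion_iff (ρ : Finpartition s) (t : Finset α) {C : Finset (Finset α)}
    (hC : C ⊆ ρ.parts) : Disjoint (C.biUnion id) t ↔ Disjoint C (ρ.meeting t) := by
  rw [← not_iff_not, not_disjoint_iff, not_disjoint_iff]
  constructor
  · rintro ⟨x, hx, hxt⟩
    obtain ⟨A, hA, hxA⟩ := mem_biUnion.1 hx
    exact ⟨A, hA, mem_meeting.2 ⟨hC hA, x, hxA, hxt⟩⟩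
  · rintro ⟨A, hA, hAt⟩
    obtain ⟨_, x, hx, hxt⟩ := mem_meeting.1 hAt
    exact ⟨x, mem_biUnion.2 ⟨A, hA, hx⟩, hxt⟩

theorem blockValue_coarsen (c : ℤ) (t : Finset α) (y x : ℤ) (ρ : Finpartition s)
    (τ : Finpartition ρ.parts) :
    blockValue c t y x (ρ.coarsen τ).parts = blockValue c (ρ.meeting t) y x τ.parts := by
  have hsub : ∀ p : Finset (Finset α) → Prop, ∀ [DecidablePred p],
      #((τ.parts.filter p).image fun C => C.biUnion id) = #(τ.parts.filter p) := by
    intro p _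
    refine card_image_of_injOn (ρ.injOn_biUnion.mono fun C hC => ?_)
    exact τ.subset (mem_filter.1 hC).1
  have h1 : τ.parts.filter (fun C => ¬ Disjoint (C.biUnion id) t) =
      τ.parts.filter fun C => ¬ Disjoint C (ρ.meeting t) :=
    filter_congr fun C hC => not_congr (ρ.disjoint_biUnion_iff t (τ.subset hC))
  have h2 : τ.parts.filter (fun C => Disjoint (C.biUnion id) t) =
      τ.parts.filter fun C => Disjoint C (ρ.meeting t) :=
    filter_congr fun C hC => ρ.disjoint_biUnion_iff t (τ.subset hC)
  rw [blockValue, blockValue, parts_coarsen, filter_image, filter_image, hsub, hsub, h1, h2]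

end Finpartition

namespace MultiPointedPartition

variable {α : Type*} [DecidableEq α] {s : Finset α}

/-- All elements of `t` are pointed and, if `strict` holds, the blocks that meet `t` have no other
pointed elements. -/
def Admissible (strict : Prop) (t : Finset α) (π : MultiPointedPartition s) : Prop :=
  t ⊆ π.pointed ∧ (strict → ∀ B ∈ π.partition.parts, B ∩ π.pointed ⊆ t ∨ Disjoint B t)

theorem Admissible.of_le {strict : Prop} {t : Finset α} {π ν : MultiPointedPartition s}
    (h : π ≤ ν) (hν : Admissible strict t ν) : Admissible strict t π := by
  refine ⟨hν.1.trans h.2.1, fun hs B hB => ?_⟩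
  obtain ⟨D, hD, hBD⟩ := h.1 hB
  rcases hν.2 hs D hD with h1 | h1
  · rcases h.2.2 B hB with h2 | h2
    · exact Or.inl fun x hx => h1 (mem_inter.2 ⟨hBD (mem_inter.1 hx).1, h2 hx⟩)
    · exact Or.inr (h2.mono_right hν.1)
  · exact Or.inr (h1.mono_left hBD)

/-- The number of admissible choices for each further element of a block that meets `t`. -/
noncomputable def freeChoices (strict : Prop) : ℤ :=
  letI := Classical.dec strict
  if strict then 1 else 2

open Classical in
theorem card_admissible_pointings (strict : Prop) (t C : Finset α) :
    (#{P ∈ C.powerset | P.Nonempty ∧ C ∩ t ⊆ P ∧ (strict → P ⊆ t ∨ Disjoint C t)} : ℤ) =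
      Finpartition.pointingWeight (freeChoices strict) t C := by
  by_cases hCt : Disjoint C t
  · have h1 : {P ∈ C.powerset | P.Nonempty ∧ C ∩ t ⊆ P ∧ (strict → P ⊆ t ∨ Disjoint C t)} =
        C.powerset.erase ∅ := by
      ext P
      simp [hCt, disjoint_iff_inter_eq_empty.1 hCt, nonempty_iff_ne_empty, and_comm]
    rw [h1, card_erase_of_mem (empty_mem_powerset _), card_powerset, Finpartition.pointingWeight,
      if_pos hCt, Nat.cast_sub Nat.one_le_two_pow]
    simp
  · obtain ⟨a, haC, hat⟩ := not_disjoint_iff.1 hCt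
    have hne : ∀ P, C ∩ t ⊆ P → P.Nonempty := fun P hP => ⟨a, hP (mem_inter.2 ⟨haC, hat⟩)⟩
    rw [Finpartition.pointingWeight, if_neg hCt, freeChoices]
    split_ifs with hs
    · have h1 : {P ∈ C.powerset | P.Nonempty ∧ C ∩ t ⊆ P ∧ (strict → P ⊆ t ∨ Disjoint C t)} =
          {C ∩ t} := by
        ext P
        simp only [mem_filter, mem_powerset, mem_singleton, hs, hCt, or_false, true_imp_iff]
        constructor
        · rintro ⟨h1, -, h2, h3⟩
          exact (subset_inter h1 h3).antisymm h2
        · rintro rfl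
          exact ⟨inter_subset_left, hne _ Subset.rfl, Subset.rfl, inter_subset_right⟩
      rw [h1]
      simp
    · have h1 : {P ∈ C.powerset | P.Nonempty ∧ C ∩ t ⊆ P ∧ (strict → P ⊆ t ∨ Disjoint C t)} =
          Icc (C ∩ t) C := by
        ext P
        simp only [mem_filter, mem_powerset, mem_Icc, hs, false_imp_iff, and_true]
        exact ⟨fun h => ⟨h.2.2, h.1⟩, fun h => ⟨h.2, hne P h.1, h.1⟩⟩
      rw [h1, card_Icc_finset inter_subset_left, card_sdiff, inter_comm t C]
      simp

open Classical in
theorem sum_admissible_eq (strict : Prop) {t : Finset α} (hts : t ⊆ s)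
    (f : Finset (Finset α) → ℤ) :
    ∑ π : MultiPointedPartition s with Admissible strict t π, f π.partition.parts =
      ∑ τ : Finpartition s, f τ.parts *
        ∏ C ∈ τ.parts, Finpartition.pointingWeight (freeChoices strict) t C := by
  have h1 : ∀ τ : Finpartition s, f τ.parts *
      ∏ C ∈ τ.parts, Finpartition.pointingWeight (freeChoices strict) t C =
      ∑ T ∈ s.powerset with ∀ C ∈ τ.parts, (C ∩ T).Nonempty ∧ C ∩ t ⊆ C ∩ T ∧
        (strict → C ∩ T ⊆ t ∨ Disjoint C t), f τ.parts := by
    intro τ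
    rw [sum_const, τ.card_filter_forall_inter fun C P => P.Nonempty ∧ C ∩ t ⊆ P ∧
      (strict → P ⊆ t ∨ Disjoint C t), nsmul_eq_mul, mul_comm]
    push_cast
    rw [prod_congr rfl fun C _ => (card_admissible_pointings strict t C).symm]
  rw [sum_congr rfl fun τ _ => h1 τ, sum_sigma']
  refine sum_bij' (fun π _ => ⟨π.partition, π.pointed⟩) (fun x hx => ⟨x.1, x.2,
    mem_powerset.1 (mem_filter.1 (mem_sigma.1 hx).2).1,
    fun C hC => ((mem_filter.1 (mem_sigma.1 hx).2).2 C hC).1⟩) ?_ ?_ ?_ ?_ ?_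
  · intro π hπ
    have hπ := (mem_filter.1 hπ).2
    refine mem_sigma.2 ⟨mem_univ _, mem_filter.2 ⟨mem_powerset.2 π.pointed_subset,
      fun C hC => ⟨π.nonempty_inter C hC, inter_subset_inter_left hπ.1, fun hs => hπ.2 hs C hC⟩⟩⟩
  · intro x hx
    have hx := (mem_filter.1 (mem_sigma.1 hx).2).2
    refine mem_filter.2 ⟨mem_univ _, fun a ha => ?_, fun hs C hC => (hx C hC).2.2 hs⟩
    obtain ⟨C, hC, haC⟩ := x.1.exists_mem (hts ha)
    exact (mem_inter.1 ((hx C hC).2.1 (mem_inter.2 ⟨haC, ha⟩))).2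
  · intros; rfl
  · intros; rfl
  · intros; rfl

/-- The multi-pointed partition of `s` obtained by gathering the blocks of `π` according to a
multi-pointed partition of the set of blocks of `π`. -/
def coarsen (π : MultiPointedPartition s) (ξ : MultiPointedPartition π.partition.parts) :
    MultiPointedPartition s where
  partition := π.partition.coarsen ξ.partition
  pointed := ξ.pointed.biUnion fun A => A ∩ π.pointed
  pointed_subset := biUnion_subset.2 fun _ _ => inter_subset_right.trans π.pointed_subset
  nonempty_inter B hB := by
    obtain ⟨C, hC, rfl⟩ := mem_image.1 hB
    obtain ⟨A, hA⟩ := ξ.nonempty_inter C hC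
    obtain ⟨hAC, hAξ⟩ := mem_inter.1 hA
    obtain ⟨x, hx⟩ := π.nonempty_inter A (ξ.pointed_subset hAξ)
    exact ⟨x, mem_inter.2 ⟨mem_biUnion.2 ⟨A, hAC, (mem_inter.1 hx).1⟩, mem_biUnion.2 ⟨A, hAξ, hx⟩⟩⟩

theorem mem_pointed_coarsen {π : MultiPointedPartition s}
    {ξ : MultiPointedPartition π.partition.parts} {A : Finset α} (hA : A ∈ π.partition.parts)
    {x : α} (hx : x ∈ A) :
    x ∈ (π.coarsen ξ).pointed ↔ A ∈ ξ.pointed ∧ x ∈ π.pointed := by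
  constructor
  · intro h
    obtain ⟨A', hA', hx'⟩ := mem_biUnion.1 h
    rw [mem_inter] at hx'
    rw [π.partition.eq_of_mem_parts hA (ξ.pointed_subset hA') hx hx'.1]
    exact ⟨hA', hx'.2⟩
  · exact fun h => mem_biUnion.2 ⟨A, h.1, mem_inter.2 ⟨hx, h.2⟩⟩

theorem le_coarsen (π : MultiPointedPartition s) (ξ : MultiPointedPartition π.partition.parts) :
    π ≤ π.coarsen ξ := by
  refine ⟨π.partition.le_coarsen _, biUnion_subset.2 fun _ _ => inter_subset_right, fun A hA => ?_⟩
  by_cases hAξ : A ∈ ξ.pointed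
  · exact Or.inl fun x hx => (mem_pointed_coarsen hA (mem_inter.1 hx).1).2
      ⟨hAξ, (mem_inter.1 hx).2⟩
  · exact Or.inr (disjoint_left.2 fun x hx h => hAξ ((mem_pointed_coarsen hA hx).1 h).1)

/-- A multi-pointed partition above `π`, seen as a multi-pointed partition of the set of blocks
of `π`. -/
def quotient (π ν : MultiPointedPartition s) (h : π ≤ ν) :
    MultiPointedPartition π.partition.parts where
  partition := π.partition.quotient ν.partition h.1
  pointed := π.partition.parts.filter fun A => A ∩ π.pointed ⊆ ν.pointed
  pointed_subset := filter_subset _ _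
  nonempty_inter C hC := by
    obtain ⟨B, hB, rfl⟩ := mem_image.1 hC
    obtain ⟨x, hx⟩ := ν.nonempty_inter B hB
    obtain ⟨hxB, hxν⟩ := mem_inter.1 hx
    obtain ⟨A, hA, hxA⟩ := π.partition.exists_mem (ν.pointed_subset hxν)
    obtain ⟨D, hD, hAD⟩ := h.1 hA
    obtain rfl := ν.partition.eq_of_mem_parts hB hD hxB (hAD hxA)
    refine ⟨A, mem_inter.2 ⟨mem_filter.2 ⟨hA, hAD⟩, mem_filter.2 ⟨hA, ?_⟩⟩⟩
    exact (h.2.2 A hA).resolve_right fun h' => disjoint_left.1 h' hxA hxν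

theorem quotient_coarsen (π : MultiPointedPartition s)
    (ξ : MultiPointedPartition π.partition.parts) :
    π.quotient (π.coarsen ξ) (π.le_coarsen ξ) = ξ := by
  refine MultiPointedPartition.ext (π.partition.quotient_coarsen ξ.partition) ?_
  ext A
  simp only [quotient, mem_filter]
  constructor
  · rintro ⟨hA, h⟩
    obtain ⟨x, hx⟩ := π.nonempty_inter A hA
    exact ((mem_pointed_coarsen hA (mem_inter.1 hx).1).1 (h hx)).1
  · intro hA
    have hA' := ξ.pointed_subset hA
    exact ⟨hA', fun x hx => (mem_pointed_coarsen hA' (mem_inter.1 hx).1).2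
      ⟨hA, (mem_inter.1 hx).2⟩⟩

theorem coarsen_quotient (π ν : MultiPointedPartition s) (h : π ≤ ν) :
    π.coarsen (π.quotient ν h) = ν := by
  refine MultiPointedPartition.ext (π.partition.coarsen_quotient ν.partition h.1) ?_
  ext x
  by_cases hx : x ∈ s
  · obtain ⟨A, hA, hxA⟩ := π.partition.exists_mem hx
    rw [mem_pointed_coarsen hA hxA]
    simp only [quotient, mem_filter]
    constructor
    · rintro ⟨⟨-, h1⟩, h2⟩
      exact h1 (mem_inter.2 ⟨hxA, h2⟩)
    · intro hxν
      exact ⟨⟨hA, (h.2.2 A hA).resolve_right fun h' => disjoint_left.1 h' hxA hxν⟩, h.2.1 hxν⟩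
  · exact iff_of_false (fun h' => hx (pointed_subset _ h')) fun h' => hx (pointed_subset _ h')

theorem admissible_coarsen_iff {strict : Prop} {t : Finset α} {π : MultiPointedPartition s}
    (hπ : Admissible strict t π) (ξ : MultiPointedPartition π.partition.parts) :
    Admissible strict t (π.coarsen ξ) ↔ Admissible strict (π.partition.meeting t) ξ := by
  refine and_congr ⟨fun h A hA => ?_, fun h x hx => ?_⟩ (forall_congr' fun hs => ?_)
  · obtain ⟨hA, x, hxA, hxt⟩ := Finpartition.mem_meeting.1 hA
    exact ((mem_pointed_coarsen hA hxA).1 (h hxt)).1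
  · obtain ⟨A, hA, hxA⟩ := π.partition.exists_mem (π.pointed_subset (hπ.1 hx))
    exact (mem_pointed_coarsen hA hxA).2
      ⟨h (Finpartition.mem_meeting.2 ⟨hA, x, hxA, hx⟩), hπ.1 hx⟩
  · change (∀ B ∈ ξ.partition.parts.image fun C => C.biUnion id, _) ↔ _
    rw [forall_mem_image]
    refine forall₂_congr fun C hC => or_congr ⟨fun h A hA => ?_, fun h x hx => ?_⟩
      (π.partition.disjoint_biUnion_iff t (ξ.partition.subset hC))
    · obtain ⟨hAC, hAξ⟩ := mem_inter.1 hA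
      have hA := ξ.pointed_subset hAξ
      obtain ⟨x, hx⟩ := π.nonempty_inter A hA
      obtain ⟨hxA, hxπ⟩ := mem_inter.1 hx
      exact Finpartition.mem_meeting.2 ⟨hA, x, hxA, h (mem_inter.2
        ⟨mem_biUnion.2 ⟨A, hAC, hxA⟩, (mem_pointed_coarsen hA hxA).2 ⟨hAξ, hxπ⟩⟩)⟩
    · obtain ⟨hxC, hxp⟩ := mem_inter.1 hx
      obtain ⟨A, hAC, hxA⟩ := mem_biUnion.1 hxC
      have hA := ξ.partition.subset hC hAC
      obtain ⟨hAξ, hxπ⟩ := (mem_pointed_coarsen hA hxA).1 hxp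
      obtain ⟨-, z, hzA, hzt⟩ := Finpartition.mem_meeting.1 (h (mem_inter.2 ⟨hAC, hAξ⟩))
      exact (hπ.2 hs A hA).resolve_right (not_disjoint_iff.2 ⟨z, hzA, hzt⟩)
        (mem_inter.2 ⟨hxA, hxπ⟩)

open Classical in
theorem sum_admissible_ge {strict : Prop} {t : Finset α} {π : MultiPointedPartition s}
    (hπ : Admissible strict t π) (x : ℤ) :
    ∑ ν : MultiPointedPartition s with π ≤ ν ∧ Admissible strict t ν,
      Finpartition.blockValue (freeChoices strict) t x x ν.partition.parts =
        x ^ #π.partition.parts := by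
  have h1 : ∑ ν : MultiPointedPartition s with π ≤ ν ∧ Admissible strict t ν,
      Finpartition.blockValue (freeChoices strict) t x x ν.partition.parts =
      ∑ ξ : MultiPointedPartition π.partition.parts with
        Admissible strict (π.partition.meeting t) ξ,
        Finpartition.blockValue (freeChoices strict) (π.partition.meeting t) x x
          ξ.partition.parts := by
    refine (sum_bij' (fun ξ _ => π.coarsen ξ)
      (fun ν hν => π.quotient ν (mem_filter.1 hν).2.1) ?_ ?_ ?_ ?_ ?_).symm
    · intro ξ hξ
      exact mem_filter.2 ⟨mem_univ _, π.le_coarsen ξ,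
        (admissible_coarsen_iff hπ ξ).2 (mem_filter.1 hξ).2⟩
    · intro ν hν
      refine mem_filter.2 ⟨mem_univ _, (admissible_coarsen_iff hπ _).1 ?_⟩
      rw [coarsen_quotient]
      exact (mem_filter.1 hν).2.2
    · exact fun ξ _ => π.quotient_coarsen ξ
    · exact fun ν _ => π.coarsen_quotient ν _
    · exact fun ξ _ => (Finpartition.blockValue_coarsen _ t x x _ _).symm
  rw [h1, sum_admissible_eq strict (t := π.partition.meeting t) (filter_subset _ _)
    (Finpartition.blockValue (freeChoices strict) (π.partition.meeting t) x x), Finpartition.sum_blockValue_mul_prod, ← pow_add,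
    card_inter_add_card_sdiff]

end MultiPointedPartition

/-- Möbius inversion at the least element. -/
theorem sum_mu_bot_mul_of_sum_ge {P : Type*} [PartialOrder P] [OrderBot P] [Fintype P]
    [DecidableEq P] [DecidableLE P] [LocallyFiniteOrder P] {f g : P → ℤ}
    (h : ∀ a, ∑ b with a ≤ b, f b = g a) :
    ∑ a, IncidenceAlgebra.mu ℤ (⊥ : P) a * g a = f ⊥ := by
  simp_rw [← h, mul_sum, sum_filter]
  rw [sum_comm]
  have h1 : ∀ b : P, ∑ a, (if a ≤ b then IncidenceAlgebra.mu ℤ ⊥ a * f b else 0) =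
      if ⊥ = b then f b else 0 := by
    intro b
    have h2 : (univ.filter fun a : P => a ≤ b) = Icc ⊥ b := by ext; simp
    rw [← sum_filter, h2, ← sum_mul, IncidenceAlgebra.sum_Icc_mu_right]
    simp
  rw [sum_congr rfl fun b _ => h1 b, sum_ite_eq]
  simp

namespace MultiPointedPartition

variable {α : Type*} [DecidableEq α] {s : Finset α}

theorem card_parts_lt_of_lt {π ν : MultiPointedPartition s} (h : π < ν) :
    #ν.partition.parts < #π.partition.parts := by
  obtain ⟨ρ, -, h2, h3⟩ := exists_merge_of_lt h.le h.ne
  exact (Finpartition.card_mono h2.1).trans_lt h3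

theorem Merge.lt {π ν : MultiPointedPartition s} (h : Merge π ν) : π < ν := by
  refine h.le.lt_of_ne fun hne => ?_
  subst hne
  obtain ⟨B, hB, D, hD, hBD, hparts, -⟩ := h
  have h1 : B ∈ insert (B ∪ D) ((π.partition.parts.erase B).erase D) := hparts ▸ hB
  have h2 : D ∈ insert (B ∪ D) ((π.partition.parts.erase B).erase D) := hparts ▸ hD
  grind

theorem Merge.card_parts_le {π ν : MultiPointedPartition s} (h : Merge π ν) :
    #π.partition.parts ≤ #ν.partition.parts + 1 := by
  obtain ⟨B, hB, D, hD, hBD, hparts, -⟩ := h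
  have h1 : B ∪ D ∉ (π.partition.parts.erase B).erase D := by
    intro hmem
    have hm := mem_of_mem_erase (mem_of_mem_erase hmem)
    obtain ⟨x, hx⟩ := π.partition.nonempty_of_mem_parts hB
    have := π.partition.eq_of_mem_parts hm hB (mem_union_left D hx) hx
    grind
  rw [hparts, card_insert_of_notMem h1,
    card_erase_of_mem (mem_erase.2 ⟨hBD.symm, hD⟩), card_erase_of_mem hB]
  lia

theorem embedding_bot {Q : Type*} [PartialOrder Q] [OrderBot Q]
    (e : Q ↪o MultiPointedPartition s) (he : IsLowerSet (Set.range e)) : e ⊥ = ⊥ := by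
  obtain ⟨q, hq⟩ := he (bot_le (a := e ⊥)) ⟨⊥, rfl⟩
  rw [← hq]
  exact le_antisymm (e.monotone bot_le) (hq ▸ bot_le)

theorem height_add_card_parts_le {Q : Type*} [PartialOrder Q]
    (e : Q ↪o MultiPointedPartition s) (he : IsLowerSet (Set.range e)) {q r : Q} (hqr : q ≤ r) :
    Order.height q + #(e q).partition.parts ≤ Order.height r + #(e r).partition.parts := by
  induction hk : #(e q).partition.parts using Nat.strong_induction_on generalizing q with
  | _ k ih =>
  subst hk
  by_cases hne : e q = e r
  · rw [e.injective hne]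
  obtain ⟨ρ, h1, h2, h3⟩ := exists_merge_of_lt (e.monotone hqr) hne
  obtain ⟨p, rfl⟩ := he h2 ⟨r, rfl⟩
  refine le_trans ?_ (ih _ h3 (e.le_iff_le.1 h2) rfl)
  calc Order.height q + (#(e q).partition.parts : ℕ∞)
      ≤ Order.height q + ((#(e p).partition.parts + 1 : ℕ) : ℕ∞) := by
        gcongr
        exact h1.card_parts_le
    _ = Order.height q + 1 + (#(e p).partition.parts : ℕ∞) := by
        push_cast
        ring
    _ ≤ _ := by
        gcongr
        exact Order.height_add_one_le (e.lt_iff_lt.1 h1.lt)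

theorem height_eq_of_isLowerSet {Q : Type*} [PartialOrder Q] [OrderBot Q]
    (e : Q ↪o MultiPointedPartition s) (he : IsLowerSet (Set.range e)) (q : Q) :
    Order.height q = (#s - #(e q).partition.parts : ℕ) := by
  refine le_antisymm ?_ ?_
  · induction hk : #s - #(e q).partition.parts using Nat.strong_induction_on generalizing q with
    | _ k ih =>
    subst hk
    refine Order.height_le_coe_iff.2 fun r hr => ?_
    have h1 := card_parts_lt_of_lt (e.lt_iff_lt.2 hr)
    have h2 := (e r).partition.card_parts_le_card
    have h3 : #s - #(e r).partition.parts < #s - #(e q).partition.parts := by lia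
    exact (ih _ h3 r rfl).trans_lt (Nat.cast_lt.2 h3)
  · have h1 := height_add_card_parts_le e he (bot_le (a := q))
    have h2 : #(e ⊥).partition.parts = #s := by
      rw [embedding_bot e he]
      exact Finpartition.card_bot s
    rw [Order.height_bot, zero_add, h2] at h1
    cases hh : Order.height q with
    | top => exact le_top
    | coe m =>
      rw [hh] at h1
      norm_cast at h1 ⊢
      lia

theorem blockValue_bot (c : ℤ) {t : Finset α} (hts : t ⊆ s) (y x : ℤ) :
    Finpartition.blockValue c t y x (⊥ : Finpartition s).parts =
      fallingFactorial #t y * dimerCount (#s - #t) (x - c * #t) := by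
  have h1 : #((⊥ : Finpartition s).parts.filter fun C => ¬ Disjoint C t) = #t := by
    rw [Finpartition.parts_bot, filter_map, card_map]
    congr 1
    ext x
    simpa using fun h => hts h
  have h2 := card_filter_add_card_filter_not (s := (⊥ : Finpartition s).parts)
    fun C => Disjoint C t
  rw [Finpartition.card_bot, h1] at h2
  rw [Finpartition.blockValue, h1]
  congr 2
  lia

/-- The characteristic polynomial of a lower set of multi-pointed partitions consisting of the
admissible ones. -/
theorem mul_eval_posetCharPoly {Q : Type*} [PartialOrder Q] [OrderBot Q] [Fintype Q]
    (e : Q ↪o MultiPointedPartition s) {strict : Prop} {t : Finset α} (hts : t ⊆ s)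
    (hs : s.Nonempty) (he : ∀ π, π ∈ Set.range e ↔ Admissible strict t π)
    (hone : ∃ q, #(e q).partition.parts = 1) (x : ℤ) :
    x * (posetCharPoly Q).eval x =
      fallingFactorial #t x * dimerCount (#s - #t) (x - freeChoices strict * #t) := by
  classical
  have hlow : IsLowerSet (Set.range e) := fun ν π h hν =>
    (he π).2 (Admissible.of_le h ((he ν).1 hν))
  have hpos : ∀ q, 1 ≤ #(e q).partition.parts := fun q =>
    card_pos.2 ((e q).partition.parts_nonempty hs.ne_empty)
  have hle : ∀ q, #(e q).partition.parts ≤ #s := fun q => (e q).partition.card_parts_le_card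
  have hheight : ∀ q, (Order.height q).toNat = #s - #(e q).partition.parts := fun q => by
    rw [height_eq_of_isLowerSet e hlow q, ENat.toNat_natCast]
  have hsup : (univ.sup fun q : Q => (Order.height q).toNat) = #s - 1 := by
    refine le_antisymm (Finset.sup_le fun q _ => ?_) ?_
    · have := hpos q
      rw [hheight q]
      lia
    · obtain ⟨q, hq⟩ := hone
      have := le_sup (f := fun q : Q => (Order.height q).toNat) (mem_univ q)
      rwa [hheight q, hq] at this
  have hsum : ∀ q : Q, ∑ r with q ≤ r,
      Finpartition.blockValue (freeChoices strict) t x x (e r).partition.parts =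
        x ^ #(e q).partition.parts := by
    intro q
    rw [← sum_admissible_ge ((he (e q)).1 ⟨q, rfl⟩) x]
    refine sum_bij (fun r _ => e r) ?_ ?_ ?_ ?_
    · exact fun r hr => mem_filter.2 ⟨mem_univ _, e.monotone (mem_filter.1 hr).2,
        (he (e r)).1 ⟨r, rfl⟩⟩
    · exact fun _ _ _ _ h => e.injective h
    · intro ν hν
      obtain ⟨-, h1, h2⟩ := mem_filter.1 hν
      obtain ⟨r, rfl⟩ := (he ν).2 h2
      exact ⟨r, mem_filter.2 ⟨mem_univ _, e.le_iff_le.1 h1⟩, rfl⟩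
    · exact fun _ _ => rfl
  rw [← blockValue_bot _ hts]
  let _ : DecidableEq Q := Classical.decEq Q
  let _ : DecidableLE Q := Classical.decRel _
  let _ : DecidableLT Q := Classical.decRel _
  let _ : LocallyFiniteOrder Q := Fintype.toLocallyFiniteOrder
  have hinv := sum_mu_bot_mul_of_sum_ge (P := Q)
    (f := fun r => Finpartition.blockValue (freeChoices strict) t x x (e r).partition.parts)
    (g := fun q => x ^ #(e q).partition.parts) (by convert hsum)
  have hbot : (e ⊥).partition = ⊥ := by
    rw [embedding_bot e hlow]
    rfl
  rw [hbot] at hinv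
  rw [← hinv, posetCharPoly, eval_finsetSum, mul_sum]
  refine sum_congr rfl fun q _ => ?_
  rw [hsup, hheight q, eval_mul, eval_C, eval_pow, eval_X]
  have h1 := hpos q
  have h2 := hle q
  rw [show #s - 1 - (#s - #(e q).partition.parts) = #(e q).partition.parts - 1 by lia,
    mul_left_comm, mul_pow_sub_one (by lia)]

end MultiPointedPartition

theorem eval_angleBracket_succ (m : ℕ) (x : ℤ) :
    (angleBracket (m + 1)).eval x = (angleBracket m).eval x * (x - (m + 1 : ℕ)) := by
  rw [angleBracket, prod_Icc_succ_top (by lia), eval_mul, ← angleBracket]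
  simp

theorem eval_angleBracket_mul_prod_Ico {m n : ℕ} (h : m ≤ n) (x : ℤ) :
    (angleBracket m).eval x * ∏ l ∈ Ico (m + 1) (n + 1), (x - l) = (angleBracket n).eval x := by
  induction n, h using Nat.le_induction with
  | base => simp
  | succ n hmn ih => rw [prod_Ico_succ_top (by lia), ← mul_assoc, ih, eval_angleBracket_succ]

theorem fallingFactorial_mul_sub (i : ℕ) (x : ℤ) :
    fallingFactorial i x * (x - i) = x * (angleBracket i).eval x := by
  induction i with
  | zero => simp [fallingFactorial, angleBracket]
  | succ i ih =>
    rw [eval_angleBracket_succ, ← mul_assoc, ← ih]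
    congr 1
    exact prod_range_succ _ _

theorem dimerCount_mul_eval_angleBracket {k d : ℕ} (h : 1 ≤ k + d) (x : ℤ) :
    dimerCount k (x - d) * (angleBracket (k + d)).eval x =
      (x - d) * (angleBracket (2 * k + d - 1)).eval x := by
  rcases k with _ | k
  · obtain ⟨d, rfl⟩ : ∃ d', d = d' + 1 := ⟨d - 1, by lia⟩
    simp only [zero_add, mul_zero, Nat.add_sub_cancel, dimerCount_zero, one_mul,
      eval_angleBracket_succ]
    ring
  · have h1 : ∏ l ∈ Ico (k + 1 + 1) (2 * (k + 1)), (x - d - (l : ℤ)) =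
        ∏ l ∈ Ico (k + 1 + d + 1) (2 * (k + 1) + d - 1 + 1), (x - (l : ℤ)) := by
      rw [show k + 1 + d + 1 = k + 1 + 1 + d by ring,
        show 2 * (k + 1) + d - 1 + 1 = 2 * (k + 1) + d by lia, ← prod_Ico_add']
      exact prod_congr rfl fun l _ => by push_cast; ring
    rw [dimerCount, if_neg (Nat.succ_ne_zero k), h1,
      ← eval_angleBracket_mul_prod_Ico (show k + 1 + d ≤ 2 * (k + 1) + d - 1 by lia)]
    ring

theorem eval_zero_angleBracket (m : ℕ) : (angleBracket m).eval 0 = (-1) ^ m * m.factorial := by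
  induction m with
  | zero => simp [angleBracket]
  | succ m ih =>
    rw [eval_angleBracket_succ, ih, Nat.factorial_succ]
    push_cast
    ring

theorem angleBracket_ne_zero (m : ℕ) : angleBracket m ≠ 0 :=
  prod_ne_zero_iff.2 fun _ _ => X_sub_C_ne_zero _

theorem algebraMap_eq_div_of_mul_eq {p q r : ℤ[X]} (hq : q ≠ 0) (h : p * q = r) :
    algebraMap ℤ[X] (RatFunc ℤ) p = algebraMap ℤ[X] (RatFunc ℤ) r / algebraMap ℤ[X] (RatFunc ℤ) q := by
  rw [eq_div_iff (RatFunc.algebraMap_ne_zero hq), ← map_mul, h]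

namespace MultiPointedPartition

theorem card_parts_oneBlock {α : Type*} [DecidableEq α] {s p : Finset α} (hp : p.Nonempty)
    (hps : p ⊆ s) : #(oneBlock p hp hps).partition.parts = 1 := card_singleton s

theorem le_oneBlock_iff {α : Type*} [DecidableEq α] {s p : Finset α} (hp : p.Nonempty)
    (hps : p ⊆ s) (π : MultiPointedPartition s) :
    π ≤ oneBlock p hp hps ↔ Admissible True p π := by
  rw [le_def, Admissible]
  refine ⟨fun h => ⟨h.2.1, fun _ => h.2.2⟩, fun h => ⟨fun B hB => ?_, h.1, h.2 trivial⟩⟩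
  exact ⟨s, mem_singleton_self s, π.partition.subset hB⟩

theorem mul_eval_posetCharPoly_withPointed {n i : ℕ} (hn : 1 ≤ n) (hi : i ≤ n) (x : ℤ) :
    x * (posetCharPoly (WithPointed (s := Icc 1 n) (Icc 1 i) (Icc_subset_Icc_right hi))).eval x =
      fallingFactorial i x * dimerCount (n - i) (x - 2 * i) := by
  have hs : (Icc 1 n).Nonempty := nonempty_Icc.2 hn
  have h := mul_eval_posetCharPoly
    (Q := WithPointed (s := Icc 1 n) (Icc 1 i) (Icc_subset_Icc_right hi))
    (⟨⟨Subtype.val, Subtype.val_injective⟩, Iff.rfl⟩) (strict := False)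
    (Icc_subset_Icc_right hi) hs
    (fun π => ⟨by rintro ⟨q, rfl⟩; exact ⟨q.2, False.elim⟩, fun h => ⟨⟨π, h.1⟩, rfl⟩⟩)
    ⟨⟨oneBlock (Icc 1 n) hs Subset.rfl, Icc_subset_Icc_right hi⟩, card_parts_oneBlock hs Subset.rfl⟩ x
  simpa [freeChoices] using h

theorem mul_eval_posetCharPoly_univ {n : ℕ} (hn : 1 ≤ n) (x : ℤ) :
    x * (posetCharPoly (MultiPointedPartition (Icc 1 n))).eval x = dimerCount n x := by
  have hs : (Icc 1 n).Nonempty := nonempty_Icc.2 hn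
  have h := mul_eval_posetCharPoly (Q := MultiPointedPartition (Icc 1 n))
    (RelEmbedding.refl _) (strict := False) (empty_subset _) hs
    (fun π => ⟨fun _ => ⟨empty_subset _, False.elim⟩, fun _ => ⟨π, rfl⟩⟩)
    ⟨oneBlock (Icc 1 n) hs Subset.rfl, card_parts_oneBlock hs Subset.rfl⟩ x
  simpa [freeChoices, fallingFactorial_zero] using h

theorem mul_eval_posetCharPoly_maximalInterval {n : ℕ} (hn : 1 ≤ n) {p : Finset ℕ}
    (hp : p.Nonempty) (hps : p ⊆ Icc 1 n) (x : ℤ) :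
    x * (posetCharPoly (MaximalInterval p hp hps)).eval x =
      fallingFactorial #p x * dimerCount (n - #p) (x - #p) := by
  have h := mul_eval_posetCharPoly (Q := MaximalInterval p hp hps)
    (OrderEmbedding.subtype _) (strict := True) hps (nonempty_Icc.2 hn)
    (fun π => by
      rw [← le_oneBlock_iff hp hps]
      exact ⟨by rintro ⟨q, rfl⟩; exact q.2, fun h => ⟨⟨π, h⟩, rfl⟩⟩)
    ⟨⟨oneBlock p hp hps, Set.mem_Iic.2 le_rfl⟩, card_parts_oneBlock hp hps⟩ x
  simpa [freeChoices] using h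

theorem posetCharPoly_withPointed_mul {n i : ℕ} (hn : 1 ≤ n) (hi : i ≤ n) :
    posetCharPoly (WithPointed (s := Icc 1 n) (Icc 1 i) (Icc_subset_Icc_right hi)) *
      ((X - C (i : ℤ)) * angleBracket (n + i)) =
      (X - C (2 * i : ℤ)) * (angleBracket i * angleBracket (2 * n - 1)) := by
  refine mul_left_cancel₀ X_ne_zero (Polynomial.funext fun x => ?_)
  simp only [eval_mul, eval_sub, eval_X, eval_C]
  have h1 := mul_eval_posetCharPoly_withPointed hn hi x
  have h2 := fallingFactorial_mul_sub i x
  have h3 := dimerCount_mul_eval_angleBracket (k := n - i) (d := 2 * i) (by lia) x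
  rw [show n - i + 2 * i = n + i by lia, show 2 * (n - i) + 2 * i - 1 = 2 * n - 1 by lia] at h3
  push_cast at h3
  rw [← mul_assoc, h1, mul_mul_mul_comm, h2, h3]
  ring

theorem mul_angleBracket_eq_of_mul_eval {n i : ℕ} (hn : 1 ≤ n) (hi : i ≤ n) {P : ℤ[X]}
    (hP : ∀ x, x * P.eval x = fallingFactorial i x * dimerCount (n - i) (x - i)) :
    P * angleBracket n = angleBracket i * angleBracket (2 * n - i - 1) := by
  refine mul_left_cancel₀ X_ne_zero (Polynomial.funext fun x => ?_)
  simp only [eval_mul, eval_X]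
  have h2 := fallingFactorial_mul_sub i x
  have h3 := dimerCount_mul_eval_angleBracket (k := n - i) (d := i) (by lia) x
  rw [show n - i + i = n by lia, show 2 * (n - i) + i - 1 = 2 * n - i - 1 by lia] at h3
  rw [← mul_assoc, hP, mul_assoc, h3, ← mul_assoc, h2, mul_assoc]

theorem coeff_zero_of_mul_angleBracket_eq {n i : ℕ} (hn : 1 ≤ n) (hi : i ≤ n) {P : ℤ[X]}
    (hP : P * angleBracket n = angleBracket i * angleBracket (2 * n - i - 1)) :
    (P.coeff 0 : ℚ) = (-1) ^ (n - 1) *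
      (((Nat.factorial i : ℚ) * Nat.factorial (2 * n - i - 1)) / Nat.factorial n) := by
  have h := congrArg (fun p : ℤ[X] => ((p.eval 0 : ℤ) : ℚ)) hP
  simp only [eval_mul, eval_zero_angleBracket, ← coeff_zero_eq_eval_zero P] at h
  push_cast at h
  have hn0 : (n.factorial : ℚ) ≠ 0 := by positivity
  obtain ⟨m, rfl⟩ : ∃ m, n = m + 1 := ⟨n - 1, by lia⟩
  have hsign : (-1 : ℚ) ^ i * (-1) ^ (2 * (m + 1) - i - 1) = -1 := by
    rw [← pow_add, show i + (2 * (m + 1) - i - 1) = 2 * m + 1 by lia, pow_succ, pow_mul]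
    simp
  have hsq : (-1 : ℚ) ^ m * (-1) ^ m = 1 := by rw [← mul_pow]; simp
  rw [mul_div_assoc', eq_div_iff hn0, Nat.add_sub_cancel]
  rw [pow_succ] at h
  linear_combination -(-1 : ℚ) ^ m * h - (-1 : ℚ) ^ m * i.factorial *
    (2 * (m + 1) - i - 1).factorial * hsign - (P.coeff 0 : ℚ) * (m + 1).factorial * hsq

theorem coeff_zero_of_mul_sub_mul_angleBracket_eq {n i : ℕ} (hi1 : 1 ≤ i) (hi : i ≤ n) {P : ℤ[X]}
    (hP : P * ((X - C (i : ℤ)) * angleBracket (n + i)) =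
      (X - C (2 * i : ℤ)) * (angleBracket i * angleBracket (2 * n - 1))) :
    (P.coeff 0 : ℚ) = (-1) ^ (n - 1) * 2 *
      (((Nat.factorial i : ℚ) * Nat.factorial (2 * n - 1)) / Nat.factorial (n + i)) := by
  have h := congrArg (fun p : ℤ[X] => ((p.eval 0 : ℤ) : ℚ)) hP
  simp only [eval_mul, eval_sub, eval_X, eval_C, eval_zero_angleBracket,
    ← coeff_zero_eq_eval_zero P] at h
  push_cast at h
  have hn0 : ((n + i).factorial : ℚ) ≠ 0 := by positivity
  have hi0 : (i : ℚ) ≠ 0 := by positivity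
  obtain ⟨m, rfl⟩ : ∃ m, n = m + 1 := ⟨n - 1, by lia⟩
  have hodd : (-1 : ℚ) ^ (2 * (m + 1) - 1) = -1 := by
    rw [show 2 * (m + 1) - 1 = 2 * m + 1 by lia, pow_succ, pow_mul]
    simp
  have hsq : (-1 : ℚ) ^ m * (-1) ^ m = 1 := by rw [← mul_pow]; simp
  have hsqi : (-1 : ℚ) ^ i * (-1) ^ i = 1 := by rw [← mul_pow]; simp
  rw [mul_div_assoc', eq_div_iff hn0, Nat.add_sub_cancel]
  refine mul_left_cancel₀ hi0 ?_
  rw [hodd, show m + 1 + i = m + i + 1 by ring, pow_succ, pow_add] at h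
  rw [show m + 1 + i = m + i + 1 by ring]
  clear hodd
  generalize ((-1 : ℚ) ^ m) = u at *
  generalize ((-1 : ℚ) ^ i) = v at *
  generalize (P.coeff 0 : ℚ) = a at *
  linear_combination u * v * h + (2 * i * u * i.factorial * (2 * (m + 1) - 1).factorial -
    a * i * (m + i + 1).factorial * u * u) * hsqi - a * i * (m + i + 1).factorial * hsq

end MultiPointedPartition

theorem mainTheorem4 (n : ℕ) (hn : 1 ≤ n) :
    -- the multi-pointed partitions of `[n]` in which the elements of `[i]` are pointed
    (∀ i : ℕ, 1 ≤ i → ∀ hi : i ≤ n,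
      (algebraMap ℤ[X] (RatFunc ℤ)
          (posetCharPoly (MultiPointedPartition.WithPointed (s := Icc 1 n) (Icc 1 i)
            (Icc_subset_Icc_right hi))) =
        algebraMap ℤ[X] (RatFunc ℤ) (X - C (2 * i : ℤ)) / algebraMap ℤ[X] (RatFunc ℤ) (X - C (i : ℤ)) *
          (algebraMap ℤ[X] (RatFunc ℤ) (angleBracket i * angleBracket (2 * n - 1)) /
            algebraMap ℤ[X] (RatFunc ℤ) (angleBracket (n + i)))) ∧
      ((posetCharPoly (MultiPointedPartition.WithPointed (s := Icc 1 n) (Icc 1 i)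
          (Icc_subset_Icc_right hi))).coeff 0 : ℚ) =
        (-1) ^ (n - 1) * 2 *
          (((Nat.factorial i : ℚ) * Nat.factorial (2 * n - 1)) / Nat.factorial (n + i))) ∧
    -- the maximal intervals, below a single block with `i` pointed elements
    (∀ i : ℕ, 1 ≤ i → i ≤ n → ∀ (p : Finset ℕ) (hp : p.Nonempty) (hps : p ⊆ Icc 1 n), #p = i →
      (algebraMap ℤ[X] (RatFunc ℤ)
          (posetCharPoly (MultiPointedPartition.MaximalInterval p hp hps)) =
        algebraMap ℤ[X] (RatFunc ℤ) (angleBracket i * angleBracket (2 * n - i - 1)) /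
          algebraMap ℤ[X] (RatFunc ℤ) (angleBracket n)) ∧
      ((posetCharPoly (MultiPointedPartition.MaximalInterval p hp hps)).coeff 0 : ℚ) =
        (-1) ^ (n - 1) *
          (((Nat.factorial i : ℚ) * Nat.factorial (2 * n - i - 1)) / Nat.factorial n)) ∧
    -- the poset of all multi-pointed partitions of `[n]` (the case `i = 0`)
    (algebraMap ℤ[X] (RatFunc ℤ) (posetCharPoly (MultiPointedPartition (Icc 1 n))) =
      algebraMap ℤ[X] (RatFunc ℤ) (angleBracket (2 * n - 1)) /
        algebraMap ℤ[X] (RatFunc ℤ) (angleBracket n)) ∧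
    posetCharPoly (MultiPointedPartition (Icc 1 n)) = ∏ k ∈ Icc (n + 1) (2 * n - 1), (X - C (k : ℤ)) ∧
    ((posetCharPoly (MultiPointedPartition (Icc 1 n))).coeff 0 : ℚ) =
      (-1) ^ (n - 1) * ((Nat.factorial (2 * n - 1) : ℚ) / Nat.factorial n) := by
  have huniv := MultiPointedPartition.mul_angleBracket_eq_of_mul_eval hn (Nat.zero_le n)
    (P := posetCharPoly (MultiPointedPartition (Icc 1 n))) fun x => by
      rw [MultiPointedPartition.mul_eval_posetCharPoly_univ hn]
      simp [fallingFactorial_zero]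
  have hzero : angleBracket 0 = 1 := by simp [angleBracket]
  refine ⟨fun i hi1 hi => ⟨?_, ?_⟩, fun i hi1 hi p hp hps hpi => ?_, ?_, ?_, ?_⟩
  · rw [div_mul_div_comm, ← map_mul, ← map_mul]
    exact algebraMap_eq_div_of_mul_eq
      (mul_ne_zero (X_sub_C_ne_zero _) (angleBracket_ne_zero _))
      (MultiPointedPartition.posetCharPoly_withPointed_mul hn hi)
  · exact MultiPointedPartition.coeff_zero_of_mul_sub_mul_angleBracket_eq hi1 hi
      (MultiPointedPartition.posetCharPoly_withPointed_mul hn hi)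
  · subst hpi
    have h := MultiPointedPartition.mul_angleBracket_eq_of_mul_eval hn hi
      (MultiPointedPartition.mul_eval_posetCharPoly_maximalInterval hn hp hps)
    exact ⟨algebraMap_eq_div_of_mul_eq (angleBracket_ne_zero _) h,
      MultiPointedPartition.coeff_zero_of_mul_angleBracket_eq hn hi h⟩
  · refine algebraMap_eq_div_of_mul_eq (angleBracket_ne_zero _) ?_
    rw [huniv, hzero, one_mul, Nat.sub_zero]
  · refine mul_right_cancel₀ (angleBracket_ne_zero n) (Polynomial.funext fun x => ?_)
    rw [huniv, hzero, one_mul, Nat.sub_zero, eval_mul, eval_prod, mul_comm (∏ k ∈ _, _),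
      ← eval_angleBracket_mul_prod_Ico (show n ≤ 2 * n - 1 by lia)]
    congr 1
    exact prod_congr (by ext; simp) fun k _ => by simp
  · simpa using MultiPointedPartition.coeff_zero_of_mul_angleBracket_eq hn (Nat.zero_le n) huniv
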